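/- Let $\mathcal H=\mathbb C^n$ be a single-particle space, with fermionic annihilation and creation operators $c_j,c_j^\dagger$ ($1\le j\le n$) on the fermionic Fock space $\mathcal F$ over $\mathcal H$. For a density operator $\rho$ on $\mathcal F$ let $\rho^{(1)}$ be its single-particle density matrix, $\rho^{(1)}_{jj'}=\operatorname{Tr}(\rho\,c_{j'}^\dagger c_j)$, and let $\boldsymbol\lambda(\rho^{(1)})\in\mathbb R^n$ be the vector of its eigenvalues in decreasing order. For decreasing vectors $x,y\in\mathbb R^n$, $x\prec y$ means $\sum_{\nu\le m}x_\nu\le\sum_{\nu\le m}y_\nu$ for $m<n$, with equality for $m=n$. A finite family of operators $\{K_j\}$ on $\mathcal F$ is called an ONG Kraus family if $\sum_jK_j^\dagger K_j=\mathbb 1$, every $K_j$ commutes with the number operator $\sum_ic_i^\dagger c_i$, and for every density operator $\rho$ $$\boldsymbol\lambda(\rho^{(1)})\prec\sum_jp_j\,\boldsymbol\lambda(\rho_j^{(1)}),\qquad p_j=\operatorname{Tr}(\rho K_j^\dagger K_j),\quad \rho_j=K_j\rho K_j^\dagger/p_j,$$ where terms with $p_j=0$ are read as $0$. A quantum operation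 is one-body-entanglement nongenerating (ONG) if it is of the form $\rho\mapsto\sum_jK_j\rho K_j^\dagger$ for some ONG Kraus family. Let $k=\sum_j\varphi_j|j\rangle\in\mathcal H$ be a unit vector, $c_k^\dagger=\sum_j\varphi_jc_j^\dagger$, $P_k=c_k^\dagger c_k$ and $P_{\bar k}=c_kc_k^\dagger$. For $\alpha,\beta,\gamma,\delta\in\mathbb C$ put $$M_k=\alpha P_k+\beta P_{\bar k},\qquad M_{\bar k}=\gamma P_k+\delta P_{\bar k}.$$ Then $M_k^\dagger M_k+M_{\bar k}^\dagger M_{\bar k}=\mathbb 1$ if and only if $|\alpha|^2+|\gamma|^2=|\beta|^2+|\delta|^2=1$, and in that case $\{M_k,M_{\bar k}\}$ is an ONG Kraus family; in particular the generalized single-mode measurement $\rho\mapsto M_k\rho M_k^\dagger+M_{\bar k}\rho M_{\bar k}^\dagger$ is ONG. Moreover, every finite family $\{K_j\}$ with $\sum_jK_j\rho K_j^\dagger=P_k\rho P_k+P_{\bar k}\rho P_{\bar k}$ for all operators $\rho$ on $\mathcal F$ (any Kraus representation of the occupation-measurement channel) is an ONG Kraus family. -/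

import Mathlib

open scoped Matrix ComplexConjugate ComplexOrder

noncomputable section

namespace Fermion

/-- Linear operators on the fermionic Fock space over the single-particle space `ℂⁿ`, as matrices
in the occupation-number basis: the basis vector `|S⟩`, `S ⊆ {0, …, n-1}`, is the Slater
determinant in which exactly the modes in `S` are occupied. The adjoint is `ᴴ`. -/
abbrev Op (n : ℕ) := Matrix (Finset (Fin n)) (Finset (Fin n)) ℂ

/-- Annihilation operator of the `j`-th basis mode:
`c_j |T⟩ = (-1)^{#{i ∈ T : i < j}} |T \ {j}⟩` if `j ∈ T`, and `c_j |T⟩ = 0` otherwise.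
The creation operator is `(annihilate j)ᴴ`. -/
def annihilate {n : ℕ} (j : Fin n) : Op n := fun S T =>
  if j ∈ T ∧ S = T.erase j then (-1) ^ (T.filter (fun i => i < j)).card else 0

/-- Annihilation operator `c_φ = ∑ j, conj (φ j) c_j` of the mode with single-particle
state `φ`; its adjoint is `c_φ† = ∑ j, φ j c_j†`. -/
def modeAnnihilate {n : ℕ} (φ : EuclideanSpace ℂ (Fin n)) : Op n :=
  ∑ j, conj (φ j) • annihilate j

/-- `P_φ = c_φ† c_φ`: the mode `φ` is occupied. -/
def occProj {n : ℕ} (φ : EuclideanSpace ℂ (Fin n)) : Op n :=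
  (modeAnnihilate φ)ᴴ * modeAnnihilate φ

/-- `c_φ c_φ†`: the mode `φ` is empty. -/
def emptyProj {n : ℕ} (φ : EuclideanSpace ℂ (Fin n)) : Op n :=
  modeAnnihilate φ * (modeAnnihilate φ)ᴴ

/-- The fermion number operator `∑ j, c_j† c_j`. -/
def numberOp (n : ℕ) : Op n := ∑ j : Fin n, (annihilate j)ᴴ * annihilate j

/-- Density operators on Fock space (pure states are those of the form `|Ψ⟩⟨Ψ|`). -/
structure IsState {n : ℕ} (ρ : Op n) : Prop where
  posSemidef : ρ.PosSemidef
  trace_eq_one : ρ.trace = 1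

/-- The single-particle density matrix, `ρ⁽¹⁾_{k k'} = Tr (ρ c_{k'}† c_k)`. -/
def spdm {n : ℕ} (ρ : Op n) : Matrix (Fin n) (Fin n) ℂ := fun k k' =>
  (ρ * ((annihilate k')ᴴ * annihilate k)).trace

theorem spdm_isHermitian {n : ℕ} {ρ : Op n} (h : ρ.IsHermitian) : (spdm ρ).IsHermitian := by
  ext k k'
  simp only [spdm, Matrix.conjTranspose_apply]
  rw [← Matrix.trace_conjTranspose, Matrix.conjTranspose_mul, h.eq, Matrix.conjTranspose_mul,
    Matrix.conjTranspose_conjTranspose, Matrix.trace_mul_comm]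

/-- The eigenvalues of a Hermitian `n × n` matrix, repeated with multiplicity and sorted in
decreasing order. -/
def sortedEigenvalues {n : ℕ} {A : Matrix (Fin n) (Fin n) ℂ} (hA : A.IsHermitian) : Fin n → ℝ :=
  fun i => hA.eigenvalues₀ (Fin.cast (Fintype.card_fin n).symm i)

/-- `λ(ρ⁽¹⁾)`: the decreasing spectrum of the single-particle density matrix of `ρ`. -/
def spdmSpectrum {n : ℕ} (ρ : Op n) (h : ρ.IsHermitian) : Fin n → ℝ :=
  sortedEigenvalues (spdm_isHermitian h)

/-- Majorization `x ≺ y` of vectors whose entries are in decreasing order. -/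
structure Majorized {n : ℕ} (x y : Fin n → ℝ) : Prop where
  antitone_left : Antitone x
  antitone_right : Antitone y
  partial_sum_le : ∀ m : ℕ, m < n →
    ∑ i with (i : Fin n).val < m, x i ≤ ∑ i with (i : Fin n).val < m, y i
  sum_eq : ∑ i, x i = ∑ i, y i

/-- The probability `Tr (ρ K† K)` of the outcome with Kraus operator `K`. -/
def outcomeProb {n : ℕ} (K ρ : Op n) : ℝ := (ρ * (Kᴴ * K)).trace.re

/-- The conditional state `K ρ K† / p`, `p = Tr (ρ K† K)` (only used with weight `p`,
so that its value `0` at `p = 0` plays no role). -/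
def postState {n : ℕ} (K ρ : Op n) : Op n := (outcomeProb K ρ)⁻¹ • (K * ρ * Kᴴ)

theorem postState_isHermitian {n : ℕ} (K : Op n) {ρ : Op n} (h : ρ.IsHermitian) :
    (postState K ρ).IsHermitian := by
  simp [postState, Matrix.IsHermitian, Matrix.conjTranspose_smul, Matrix.conjTranspose_mul, h.eq,
    Matrix.mul_assoc]

/-- The average majorization relation `λ(ρ⁽¹⁾) ≺ ∑ j, p_j λ(ρ_j⁽¹⁾)` for all states `ρ`, where
`p_j` and `ρ_j` are the probability and the conditional state of the `j`-th outcome. -/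
def AverageMajorization {n : ℕ} {ι : Type*} [Fintype ι] (K : ι → Op n) : Prop :=
  ∀ (ρ : Op n) (hρ : IsState ρ),
    Majorized (spdmSpectrum ρ hρ.posSemidef.isHermitian)
      (fun i => ∑ j, outcomeProb (K j) ρ *
        spdmSpectrum (postState (K j) ρ)
          (postState_isHermitian (K j) hρ.posSemidef.isHermitian) i)

/-- A complete, number conserving family of Kraus operators which satisfies the average
majorization relation. -/
structure IsONGKraus {n : ℕ} {ι : Type*} [Fintype ι] (K : ι → Op n) : Prop where
  complete : ∑ j, (K j)ᴴ * K j = 1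
  number_conserving : ∀ j, Commute (K j) (numberOp n)
  average_majorization : AverageMajorization K

/-- The quantum operation `ρ ↦ ∑ j, K_j ρ K_j†`. -/
def krausMap {n : ℕ} {ι : Type*} [Fintype ι] (K : ι → Op n) : Op n → Op n :=
  fun ρ => ∑ j, K j * ρ * (K j)ᴴ

/-- The quantum operation `ε` is one-body-entanglement nongenerating: it admits a finite family of
number conserving Kraus operators satisfying the average majorization relation. -/
def IsONG {n : ℕ} (ε : Op n → Op n) : Prop :=
  ∃ (r : ℕ) (K : Fin r → Op n), IsONGKraus K ∧ ε = krausMap K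

/-- The Kraus operators `M_φ = α P_φ + β P_φ̄` and `M_φ̄ = γ P_φ + δ P_φ̄` of a generalized
measurement on the single mode `φ`. -/
def modeMeasurement {n : ℕ} (φ : EuclideanSpace ℂ (Fin n)) (α β γ δ : ℂ) : Fin 2 → Op n :=
  ![α • occProj φ + β • emptyProj φ, γ • occProj φ + δ • emptyProj φ]

/-- The occupation-measurement channel `ρ ↦ P_φ ρ P_φ + P_φ̄ ρ P_φ̄`. -/
def occupationChannel {n : ℕ} (φ : EuclideanSpace ℂ (Fin n)) : Op n → Op n :=
  fun ρ => occProj φ * ρ * occProj φ + emptyProj φ * ρ * emptyProj φ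

end Fermion

end

/-!
Measuring the occupation of one mode `k` can only spread the spectrum of the single-particle density
matrix, on average over the outcomes, because the problem reduces to the two-dimensional space
spanned by `k` and one further mode.

All Kraus families in question consist of combinations `K_j = α_j P_k + β_j c_k c_k†` with
`∑ |α_j|² = ∑ |β_j|² = 1`: for the channel `ρ ↦ P_k ρ P_k + c_k c_k† ρ c_k c_k†` this is
`exists_combination_of_krausMap_eq`. By Ky Fan's principle the sum of the `m` largest eigenvalues
of `ρ⁽¹⁾` is the maximum of the total mean occupation `∑ Tr (ρ c_w† c_w)` of `m` orthonormal modes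
`w`, and a maximizing family may be rotated inside its span until all of its members but one, `w₀`,
are orthogonal to `k` (`exists_orthonormal_sum_re_inner_eq`). The occupations of the modes
orthogonal to `k` are preserved by the measurement on average. For `w₀`, write
`w₀ = s̄ k + t̄ v` with `v` a unit vector orthogonal to `k`. The contribution of doubly occupied pairs
`k, v` is again preserved on average, and on singly occupied pairs the occupations are given by a
positive `2 × 2` matrix `X`, which becomes `D_j X D_j†`, `D_j = diag(α_j, β_j)`, for the outcome
`j`. Since `∑ D_j† D_j = 1`, the largest eigenvalues satisfy `λ(X) ≤ ∑ λ(D_j X D_j†)`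
(`exists_unit_pairs_norm_sq_le_sum`). So for each outcome `w₀` can be replaced by some mode in
`span {k, w₀}`, hence orthogonal to the other modes, without loss on average, and Ky Fan's
inequality for the conditional states gives the partial-sum inequalities. Equality of the total sums
is conservation of the particle number.
-/

noncomputable section

namespace Fermion

/-! ### Canonical anticommutation relations -/

theorem mul_annihilate_apply {n : ℕ} (M : Op n) (j : Fin n) (S T : Finset (Fin n)) :
    (M * annihilate j) S T =
      if j ∈ T then M S (T.erase j) * (-1) ^ (T.filter (· < j)).card else 0 := by
  rw [Matrix.mul_apply]
  by_cases h : j ∈ T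
  · rw [Finset.sum_eq_single (T.erase j)] <;> simp +contextual [annihilate, h]
  · simp [annihilate, h]

theorem mul_annihilate_conjTranspose_apply {n : ℕ} (M : Op n) (j : Fin n)
    (S T : Finset (Fin n)) :
    (M * (annihilate j)ᴴ) S T =
      if j ∈ T then 0 else M S (insert j T) * (-1) ^ (T.filter (· < j)).card := by
  rw [Matrix.mul_apply]
  by_cases h : j ∈ T
  · rw [if_pos h]
    refine Finset.sum_eq_zero fun U _ => ?_
    have : ¬ (j ∈ U ∧ T = U.erase j) := by rintro ⟨-, rfl⟩; simp at h
    simp [annihilate, this]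
  · rw [Finset.sum_eq_single (insert j T), if_neg h]
    · simp [annihilate, h, Finset.filter_insert]
    · intro U _ hU
      have : ¬ (j ∈ U ∧ T = U.erase j) := by
        rintro ⟨hj, rfl⟩; exact hU (Finset.insert_erase hj).symm
      simp [annihilate, this]
    · simp

/-- Emptying a mode `i < j` flips the sign that `c_j` picks up. -/
theorem card_filter_lt_erase {n : ℕ} {i j : Fin n} {T : Finset (Fin n)} (hi : i ∈ T) :
    (-1 : ℂ) ^ ((T.erase i).filter (· < j)).card =
      (if i < j then -1 else 1) * (-1) ^ (T.filter (· < j)).card := by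
  rw [Finset.filter_erase]
  split_ifs with h
  · have hm : i ∈ T.filter (· < j) := by simp [hi, h]
    rw [← Finset.card_erase_add_one hm, pow_succ]; ring
  · rw [Finset.erase_eq_of_notMem (by simp [h]), one_mul]

/-- Filling a mode `i < j` flips the sign that `c_j` picks up. -/
theorem card_filter_lt_insert {n : ℕ} {i j : Fin n} {T : Finset (Fin n)} (hi : i ∉ T) :
    (-1 : ℂ) ^ ((insert i T).filter (· < j)).card =
      (if i < j then -1 else 1) * (-1) ^ (T.filter (· < j)).card := by
  rw [Finset.filter_insert]
  split_ifs with h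
  · rw [Finset.card_insert_of_notMem (by simp [hi]), pow_succ]; ring
  · rw [one_mul]

theorem annihilate_apply_eq {n : ℕ} (j : Fin n) (S T : Finset (Fin n)) :
    annihilate j S T =
      if j ∈ T then (1 : Op n) S (T.erase j) * (-1) ^ (T.filter (· < j)).card else 0 := by
  rw [← mul_annihilate_apply, one_mul]

theorem annihilate_conjTranspose_apply_eq {n : ℕ} (j : Fin n) (S T : Finset (Fin n)) :
    (annihilate j)ᴴ S T =
      if j ∈ T then 0 else (1 : Op n) S (insert j T) * (-1) ^ (T.filter (· < j)).card := by
  rw [← mul_annihilate_conjTranspose_apply, one_mul]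

/-- Canonical anticommutation relation `{c_i, c_j} = 0`. -/
theorem annihilate_mul_annihilate {n : ℕ} (i j : Fin n) :
    annihilate i * annihilate j = -(annihilate j * annihilate i) := by
  ext S T
  rw [Matrix.neg_apply, mul_annihilate_apply, mul_annihilate_apply, annihilate_apply_eq,
    annihilate_apply_eq]
  rcases eq_or_ne i j with rfl | hij
  · simp
  by_cases hi : i ∈ T <;> by_cases hj : j ∈ T <;> simp [hi, hj, hij, hij.symm]
  rw [card_filter_lt_erase hi, card_filter_lt_erase hj, Finset.erase_right_comm]
  rcases hij.lt_or_gt with h | h <;> simp [h, h.not_gt] <;> ring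

/-- Canonical anticommutation relation `{c_i, c_j†} = δ_ij`. -/
theorem annihilate_mul_conjTranspose {n : ℕ} (i j : Fin n) :
    annihilate i * (annihilate j)ᴴ + (annihilate j)ᴴ * annihilate i = if i = j then 1 else 0 := by
  ext S T
  rw [Matrix.add_apply, mul_annihilate_apply, mul_annihilate_conjTranspose_apply,
    annihilate_apply_eq, annihilate_conjTranspose_apply_eq]
  rcases eq_or_ne i j with rfl | hij
  · by_cases hi : i ∈ T
    · simp [hi, Finset.filter_erase, mul_assoc, ← pow_add, ← two_mul]
      rw [Finset.insert_erase hi]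
    · simp [hi, Finset.filter_insert, mul_assoc, ← pow_add, ← two_mul]
      rw [Finset.erase_insert hi]
  by_cases hi : i ∈ T <;> by_cases hj : j ∈ T <;> simp [hi, hj, hij, hij.symm]
  rw [card_filter_lt_erase hi, card_filter_lt_insert hj, Finset.erase_insert_of_ne hij.symm]
  rcases hij.lt_or_gt with h | h <;> simp [h, h.not_gt] <;> ring

theorem modeAnnihilate_mul_modeAnnihilate {n : ℕ} (x y : EuclideanSpace ℂ (Fin n)) :
    modeAnnihilate x * modeAnnihilate y = -(modeAnnihilate y * modeAnnihilate x) := by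
  simp only [modeAnnihilate, Finset.sum_mul_sum, Matrix.smul_mul, Matrix.mul_smul]
  rw [Finset.sum_comm, ← Finset.sum_neg_distrib]
  refine Finset.sum_congr rfl fun i _ => ?_
  rw [← Finset.sum_neg_distrib]
  refine Finset.sum_congr rfl fun j _ => ?_
  rw [annihilate_mul_annihilate j i, smul_neg, smul_neg, smul_comm]

theorem modeAnnihilate_conjTranspose {n : ℕ} (x : EuclideanSpace ℂ (Fin n)) :
    (modeAnnihilate x)ᴴ = ∑ j, x j • (annihilate j)ᴴ := by
  simp [modeAnnihilate, Matrix.conjTranspose_sum, Matrix.conjTranspose_smul]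

/-- Canonical anticommutation relation `{c_x, c_y†} = ⟪x, y⟫`,
solved for the product in antinormal order. -/
theorem modeAnnihilate_mul_conjTranspose {n : ℕ} (x y : EuclideanSpace ℂ (Fin n)) :
    modeAnnihilate x * (modeAnnihilate y)ᴴ =
      inner ℂ x y • (1 : Op n) - (modeAnnihilate y)ᴴ * modeAnnihilate x := by
  rw [eq_sub_iff_add_eq, modeAnnihilate_conjTranspose, modeAnnihilate, Finset.sum_mul_sum,
    Finset.sum_mul_sum, Finset.sum_comm (s := Finset.univ) (γ := Fin n) (f := fun i j =>
      y i • (annihilate i)ᴴ * conj (x j) • annihilate j), ← Finset.sum_add_distrib]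
  simp only [← Finset.sum_add_distrib, Matrix.smul_mul, Matrix.mul_smul]
  simp only [smul_comm (conj (x _)) (y _), ← smul_add, annihilate_mul_conjTranspose, smul_ite,
    smul_zero, Finset.sum_ite_eq, Finset.mem_univ, if_true, smul_smul, ← Finset.sum_smul]
  simp [PiLp.inner_apply]

theorem annihilate_mul_numberOp {n : ℕ} (i : Fin n) :
    annihilate i * numberOp n = numberOp n * annihilate i + annihilate i := by
  have h : ∀ j : Fin n, annihilate i * ((annihilate j)ᴴ * annihilate j) =
      (annihilate j)ᴴ * annihilate j * annihilate i + (if i = j then annihilate j else 0) := by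
    intro j
    rw [← mul_assoc, eq_sub_of_add_eq (annihilate_mul_conjTranspose i j), sub_mul, mul_assoc,
      annihilate_mul_annihilate i j, mul_assoc]
    split_ifs <;> simp [add_comm]
  simp only [numberOp, Finset.mul_sum, Finset.sum_mul, h, Finset.sum_add_distrib]
  simp

theorem numberOp_isHermitian (n : ℕ) : (numberOp n).IsHermitian := by
  simp [numberOp, Matrix.IsHermitian, Matrix.conjTranspose_sum]

theorem modeAnnihilate_mul_numberOp {n : ℕ} (x : EuclideanSpace ℂ (Fin n)) :
    modeAnnihilate x * numberOp n = numberOp n * modeAnnihilate x + modeAnnihilate x := by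
  simp only [modeAnnihilate, Finset.sum_mul, Finset.mul_sum, Matrix.smul_mul, Matrix.mul_smul,
    annihilate_mul_numberOp, smul_add, Finset.sum_add_distrib]

theorem commute_occProj_numberOp {n : ℕ} (x : EuclideanSpace ℂ (Fin n)) :
    Commute (occProj x) (numberOp n) := by
  have h := modeAnnihilate_mul_numberOp x
  have h' := congrArg Matrix.conjTranspose h
  simp only [Matrix.conjTranspose_mul, Matrix.conjTranspose_add, (numberOp_isHermitian n).eq] at h'
  rw [Commute, SemiconjBy, occProj, mul_assoc, h, mul_add, ← mul_assoc, ← mul_assoc, h', add_mul]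

/-! ### Ky Fan's maximum principle -/

/-- An orthonormal eigenbasis, numbered in the order of `sortedEigenvalues`. -/
def sortedEigenvectorBasis {n : ℕ} {A : Matrix (Fin n) (Fin n) ℂ} (hA : A.IsHermitian) :
    OrthonormalBasis (Fin n) ℂ (EuclideanSpace ℂ (Fin n)) :=
  hA.eigenvectorBasis.reindex
    ((finCongr (Fintype.card_fin n).symm).trans
      (Fintype.equivOfCardEq (Fintype.card_fin _))).symm

theorem sortedEigenvalues_eq {n : ℕ} {A : Matrix (Fin n) (Fin n) ℂ} (hA : A.IsHermitian)
    (i : Fin n) : sortedEigenvalues hA i = hA.eigenvalues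
      (((finCongr (Fintype.card_fin n).symm).trans
        (Fintype.equivOfCardEq (Fintype.card_fin _))) i) := by
  simp [sortedEigenvalues, Matrix.IsHermitian.eigenvalues]

theorem sortedEigenvalues_antitone {n : ℕ} {A : Matrix (Fin n) (Fin n) ℂ} (hA : A.IsHermitian) :
    Antitone (sortedEigenvalues hA) :=
  fun _ _ h => hA.eigenvalues₀_antitone h

theorem sum_sortedEigenvalues {n : ℕ} {A : Matrix (Fin n) (Fin n) ℂ} (hA : A.IsHermitian) :
    ∑ i, sortedEigenvalues hA i = A.trace.re := by
  simp only [sortedEigenvalues_eq]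
  rw [Equiv.sum_comp _ hA.eigenvalues, hA.trace_eq_sum_eigenvalues]
  simp

theorem toEuclideanLin_sortedEigenvectorBasis {n : ℕ} {A : Matrix (Fin n) (Fin n) ℂ}
    (hA : A.IsHermitian) (i : Fin n) :
    Matrix.toEuclideanLin A (sortedEigenvectorBasis hA i) =
      (sortedEigenvalues hA i : ℂ) • sortedEigenvectorBasis hA i := by
  rw [sortedEigenvalues_eq, sortedEigenvectorBasis, OrthonormalBasis.reindex_apply, Equiv.symm_symm]
  apply PiLp.ext
  intro j
  have := congrFun (hA.mulVec_eigenvectorBasis (((finCongr (Fintype.card_fin n).symm).trans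
        (Fintype.equivOfCardEq (Fintype.card_fin _))) i)) j
  simpa [Matrix.toLpLin_apply] using this

theorem re_inner_toEuclideanLin_eq_sum {n : ℕ} {A : Matrix (Fin n) (Fin n) ℂ}
    (hA : A.IsHermitian) (x : EuclideanSpace ℂ (Fin n)) :
    (inner ℂ x (Matrix.toEuclideanLin A x)).re =
      ∑ l, sortedEigenvalues hA l * ‖inner ℂ (sortedEigenvectorBasis hA l) x‖ ^ 2 := by
  rw [← (sortedEigenvectorBasis hA).sum_inner_mul_inner, Complex.re_sum]
  refine Finset.sum_congr rfl fun l _ => ?_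
  rw [← Matrix.isSymmetric_toEuclideanLin_iff.mpr hA, toEuclideanLin_sortedEigenvectorBasis,
    inner_smul_left, ← inner_conj_symm x, mul_left_comm, ← Complex.normSq_eq_conj_mul_self,
    Complex.normSq_eq_norm_sq, Complex.conj_ofReal, ← Complex.ofReal_mul, Complex.ofReal_re]

/-- **Ky Fan's inequality**: the expectation values of a Hermitian matrix along an orthonormal
family of `m` vectors add up to at most the sum of its `m` largest eigenvalues. -/
theorem sum_re_inner_le_sum_sortedEigenvalues {n m : ℕ} {A : Matrix (Fin n) (Fin n) ℂ}
    (hA : A.IsHermitian) (hm : m < n) {u : Fin m → EuclideanSpace ℂ (Fin n)}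
    (hu : Orthonormal ℂ u) :
    ∑ i, (inner ℂ (u i) (Matrix.toEuclideanLin A (u i))).re ≤
      ∑ l with (l : Fin n).val < m, sortedEigenvalues hA l := by
  set b := sortedEigenvectorBasis hA
  -- `t l` is the weight of the `l`-th eigenvector in the span of `u`; as `0 ≤ t l ≤ 1` and the
  -- `t l` add up to `m`, the sum `∑ l, λ_l * t l` is largest when `t` sits on the first `m` indices
  set t : Fin n → ℝ := fun l => ∑ i, ‖inner ℂ (b l) (u i)‖ ^ 2 with ht
  set μ := sortedEigenvalues hA ⟨m, hm⟩ with hμ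
  have ht0 (l) : 0 ≤ t l := Finset.sum_nonneg fun i _ => by positivity
  have ht1 (l) : t l ≤ 1 := by
    have := hu.sum_inner_products_le (b l) (s := Finset.univ)
    simpa [ht, b.norm_eq_one, norm_inner_symm (b l)] using this
  have htsum : ∑ l, t l = m := by
    simp only [ht]
    rw [Finset.sum_comm]
    simp [b.sum_sq_norm_inner_right, hu.norm_eq_one]
  have hcard : ∑ l with (l : Fin n).val < m, (1 : ℝ) = m := by
    simp [Fin.card_filter_val_lt, hm.le]
  have key : ∑ l, (sortedEigenvalues hA l - μ) * t l ≤
      ∑ l with (l : Fin n).val < m, (sortedEigenvalues hA l - μ) := by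
    rw [Finset.sum_filter]
    refine Finset.sum_le_sum fun l _ => ?_
    split_ifs with hl
    · have : μ ≤ sortedEigenvalues hA l := sortedEigenvalues_antitone hA (Fin.le_def.mpr hl.le)
      nlinarith [ht1 l]
    · have : sortedEigenvalues hA l ≤ μ :=
        sortedEigenvalues_antitone hA (by simpa [Fin.le_def] using hl)
      nlinarith [ht0 l]
  have hlhs : ∑ i, (inner ℂ (u i) (Matrix.toEuclideanLin A (u i))).re =
      ∑ l, sortedEigenvalues hA l * t l := by
    simp only [re_inner_toEuclideanLin_eq_sum hA, ht, Finset.mul_sum]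
    exact Finset.sum_comm
  rw [hlhs]
  simp only [sub_mul, Finset.sum_sub_distrib, ← Finset.mul_sum, htsum] at key
  have : ∑ l with (l : Fin n).val < m, μ = μ * m := by
    rw [← hcard, Finset.mul_sum]; simp
  linarith

/-- Some orthonormal basis has all its members but the `0`-th orthogonal to a given vector. -/
theorem exists_orthonormalBasis_apply_zero {m : ℕ} (κ : EuclideanSpace ℂ (Fin (m + 1))) :
    ∃ f : OrthonormalBasis (Fin (m + 1)) ℂ (EuclideanSpace ℂ (Fin (m + 1))),
      ∀ i ≠ 0, inner ℂ κ (f i) = 0 := by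
  rcases eq_or_ne κ 0 with rfl | hκ
  · exact ⟨EuclideanSpace.basisFun _ _, by simp⟩
  obtain ⟨f, hf⟩ := Orthonormal.exists_orthonormalBasis_extension_of_card_eq (𝕜 := ℂ)
    (E := EuclideanSpace ℂ (Fin (m + 1))) (ι := Fin (m + 1)) (by simp)
    (v := fun _ => ((‖κ‖⁻¹ : ℝ) : ℂ) • κ) (s := {0}) (by
      rw [orthonormal_subsingleton_iff]
      rintro -
      simp [Set.domRestrict, norm_smul, hκ])
  refine ⟨f, fun i hi => ?_⟩
  have h0 := hf 0 rfl
  have : κ = (‖κ‖ : ℂ) • f 0 := by simp [h0, smul_smul, hκ]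
  rw [this, inner_smul_left, f.inner_eq_zero hi.symm, mul_zero]

/-- The maximum in Ky Fan's inequality is attained on a family of which all members but one are
orthogonal to a prescribed vector `k`. -/
theorem exists_orthonormal_sum_re_inner_eq {n m : ℕ} {A : Matrix (Fin n) (Fin n) ℂ}
    (hA : A.IsHermitian) (hm : m + 1 ≤ n) (k : EuclideanSpace ℂ (Fin n)) :
    ∃ w : Fin (m + 1) → EuclideanSpace ℂ (Fin n), Orthonormal ℂ w ∧
      (∀ i ≠ 0, inner ℂ k (w i) = 0) ∧
      ∑ i, (inner ℂ (w i) (Matrix.toEuclideanLin A (w i))).re =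
        ∑ l with (l : Fin n).val < m + 1, sortedEigenvalues hA l := by
  set b := sortedEigenvectorBasis hA with hb
  have hv : Orthonormal ℂ (fun l : Fin (m + 1) => b (Fin.castLE hm l)) :=
    b.orthonormal.comp _ (Fin.castLE_injective hm)
  obtain ⟨f, hf⟩ := exists_orthonormalBasis_apply_zero
    (WithLp.toLp 2 fun l : Fin (m + 1) => inner ℂ (b (Fin.castLE hm l)) k)
  have hin (l : Fin n) (i : Fin (m + 1)) :
      inner ℂ (b l) (∑ l', f i l' • b (Fin.castLE hm l')) =
        if h : l.val < m + 1 then f i ⟨l, h⟩ else 0 := by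
    split_ifs with h
    · exact hv.inner_right_fintype (f i) ⟨l, h⟩
    · rw [inner_sum]
      refine Finset.sum_eq_zero fun l' _ => ?_
      rw [inner_smul_right, b.inner_eq_zero, mul_zero]
      rintro rfl
      exact h l'.isLt
  refine ⟨fun i => ∑ l', f i l' • b (Fin.castLE hm l'), ?_, fun i hi => ?_, ?_⟩
  · rw [orthonormal_iff_ite]
    intro i j
    rw [hv.inner_sum, ← orthonormal_iff_ite.mp f.orthonormal i j]
    simp [PiLp.inner_apply, mul_comm]
  · rw [inner_sum, ← hf i hi]
    simp [PiLp.inner_apply, inner_smul_right, mul_comm]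
  · simp only [re_inner_toEuclideanLin_eq_sum hA, ← hb, hin]
    rw [Finset.sum_comm, Finset.sum_filter]
    refine Finset.sum_congr rfl fun l _ => ?_
    split_ifs with h
    · rw [← Finset.mul_sum]
      have := f.sum_sq_norm_inner_left (EuclideanSpace.single (⟨l, h⟩ : Fin (m + 1)) (1 : ℂ))
      simp only [EuclideanSpace.inner_single_left, map_one, one_mul, PiLp.norm_single,
        norm_one, one_pow] at this
      rw [this, mul_one]
    · simp

/-! ### Largest eigenvalues of `2 × 2` Gram matrices -/

/-- The equality case of the Cauchy–Schwarz inequality in `ℂ²`. -/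
theorem exists_unit_pair_norm_sq_le (z w : ℂ) :
    ∃ s t : ℂ, ‖s‖ ^ 2 + ‖t‖ ^ 2 = 1 ∧ ‖z‖ ^ 2 + ‖w‖ ^ 2 ≤ ‖s * z + t * w‖ ^ 2 := by
  rcases eq_or_ne (‖z‖ ^ 2 + ‖w‖ ^ 2) 0 with h | h
  · exact ⟨1, 0, by simp, by rw [h]; positivity⟩
  set r := √(‖z‖ ^ 2 + ‖w‖ ^ 2) with hr
  have hr2 : r ^ 2 = ‖z‖ ^ 2 + ‖w‖ ^ 2 := Real.sq_sqrt (by positivity)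
  have hr0 : r ≠ 0 := fun h0 => h (by rw [← hr2, h0]; simp)
  refine ⟨conj z / r, conj w / r, ?_, ?_⟩
  · simp only [norm_div, RCLike.norm_conj, Complex.norm_real, Real.norm_eq_abs, div_pow, sq_abs]
    rw [← add_div, ← hr2, div_self (pow_ne_zero 2 hr0)]
  · have : conj z / r * z + conj w / r * w = r := by
      have hr2' : (r : ℂ) ^ 2 = conj z * z + conj w * w := by
        rw [Complex.conj_mul', Complex.conj_mul']
        exact_mod_cast hr2
      have hr0' : (r : ℂ) ≠ 0 := by exact_mod_cast hr0
      field_simp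
      exact hr2'.symm
    rw [this, Complex.norm_real, Real.norm_eq_abs, sq_abs, hr2]

theorem norm_mul_add_mul_sq_le (s t z w : ℂ) :
    ‖s * z + t * w‖ ^ 2 ≤ (‖s‖ ^ 2 + ‖t‖ ^ 2) * (‖z‖ ^ 2 + ‖w‖ ^ 2) := by
  have h := norm_add_le (s * z) (t * w)
  rw [norm_mul, norm_mul] at h
  have h0 := norm_nonneg (s * z + t * w)
  nlinarith [sq_nonneg (‖s‖ * ‖w‖ - ‖t‖ * ‖z‖), pow_le_pow_left₀ h0 h 2]

/-- For the Gram matrix `X` of `f, g` and the diagonal matrices `D_j = diag(α_j, β_j)`, with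
`∑ D_j† D_j = 1`, the largest eigenvalue of `X` is at most the sum of the largest eigenvalues of the
`D_j X D_j†`. With `h = s f + t g`, testing `D_j X D_j†` on the direction of
`(conj (α_j ⟪h, f⟫), conj (β_j ⟪h, g⟫))` leaves only `‖h‖⁴ ≤ |⟪h, f⟫|² + |⟪h, g⟫|²`. -/
theorem exists_unit_pairs_norm_sq_le_sum {E ι : Type*} [SeminormedAddCommGroup E]
    [InnerProductSpace ℂ E] [Fintype ι] (f g : E) {s t : ℂ} (hst : ‖s‖ ^ 2 + ‖t‖ ^ 2 = 1)
    {α β : ι → ℂ} (hα : ∑ j, ‖α j‖ ^ 2 = 1) (hβ : ∑ j, ‖β j‖ ^ 2 = 1) :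
    ∃ s' t' : ι → ℂ, (∀ j, ‖s' j‖ ^ 2 + ‖t' j‖ ^ 2 = 1) ∧
      ‖s • f + t • g‖ ^ 2 ≤ ∑ j, ‖(α j * s' j) • f + (β j * t' j) • g‖ ^ 2 := by
  set h := s • f + t • g with hh
  choose s' t' hu hle using fun j =>
    exists_unit_pair_norm_sq_le (α j * inner ℂ h f) (β j * inner ℂ h g)
  refine ⟨s', t', hu, ?_⟩
  rcases (norm_nonneg h).eq_or_lt with h0 | h0
  · rw [← h0]
    simpa using Finset.sum_nonneg fun j _ => sq_nonneg _
  have h1 : (‖h‖ ^ 2) ^ 2 ≤ ‖inner ℂ h f‖ ^ 2 + ‖inner ℂ h g‖ ^ 2 := by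
    have := norm_mul_add_mul_sq_le s t (inner ℂ h f) (inner ℂ h g)
    rw [← inner_smul_right, ← inner_smul_right, ← inner_add_right, ← hh, hst, one_mul,
      inner_self_eq_norm_sq_to_K] at this
    simpa using this
  have h2 : ‖inner ℂ h f‖ ^ 2 + ‖inner ℂ h g‖ ^ 2 ≤
      ‖h‖ ^ 2 * ∑ j, ‖(α j * s' j) • f + (β j * t' j) • g‖ ^ 2 := by
    calc ‖inner ℂ h f‖ ^ 2 + ‖inner ℂ h g‖ ^ 2
        = ∑ j, (‖α j * inner ℂ h f‖ ^ 2 + ‖β j * inner ℂ h g‖ ^ 2) := by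
          simp [mul_pow, Finset.sum_add_distrib, ← Finset.sum_mul, hα, hβ]
      _ ≤ ∑ j, ‖inner ℂ h ((α j * s' j) • f + (β j * t' j) • g)‖ ^ 2 := by
          refine Finset.sum_le_sum fun j _ => (hle j).trans_eq ?_
          rw [inner_add_right, inner_smul_right, inner_smul_right]
          ring_nf
      _ ≤ _ := by
          rw [Finset.mul_sum]
          refine Finset.sum_le_sum fun j _ => ?_
          rw [← mul_pow]
          exact pow_le_pow_left₀ (norm_nonneg _) (norm_inner_le_norm _ _) 2
  have h3 : 0 < ‖h‖ ^ 2 := by positivity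
  nlinarith

/-- `exists_unit_pairs_norm_sq_le_sum` for the semi-inner product `⟪X, Y⟫ = Tr (Y ρ X†)`. -/
theorem exists_unit_pairs_trace_le_sum {n : ℕ} {ι : Type*} [Fintype ι] {ρ : Op n}
    (hρ : ρ.PosSemidef) (f g : Op n) {s t : ℂ} (hst : ‖s‖ ^ 2 + ‖t‖ ^ 2 = 1)
    {α β : ι → ℂ} (hα : ∑ j, ‖α j‖ ^ 2 = 1) (hβ : ∑ j, ‖β j‖ ^ 2 = 1) :
    ∃ s' t' : ι → ℂ, (∀ j, ‖s' j‖ ^ 2 + ‖t' j‖ ^ 2 = 1) ∧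
      ((s • f + t • g) * ρ * (s • f + t • g)ᴴ).trace.re ≤
        ∑ j, (((α j * s' j) • f + (β j * t' j) • g) * ρ *
          ((α j * s' j) • f + (β j * t' j) • g)ᴴ).trace.re := by
  let _ : SeminormedAddCommGroup (Op n) := ρ.toMatrixSeminormedAddCommGroup hρ
  let _ : InnerProductSpace ℂ (Op n) := ρ.toMatrixInnerProductSpace hρ
  have hnorm (Y : Op n) : (Y * ρ * Yᴴ).trace.re = ‖Y‖ ^ 2 :=
    (norm_sq_eq_re_inner (𝕜 := ℂ) Y).symm
  simp only [hnorm]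
  exact exists_unit_pairs_norm_sq_le_sum f g hst hα hβ

/-! ### The algebra of one and two modes -/

theorem modeAnnihilate_add {n : ℕ} (x y : EuclideanSpace ℂ (Fin n)) :
    modeAnnihilate (x + y) = modeAnnihilate x + modeAnnihilate y := by
  simp [modeAnnihilate, add_smul, Finset.sum_add_distrib]

theorem modeAnnihilate_smul {n : ℕ} (c : ℂ) (x : EuclideanSpace ℂ (Fin n)) :
    modeAnnihilate (c • x) = conj c • modeAnnihilate x := by
  simp [modeAnnihilate, Finset.smul_sum, mul_smul]

theorem modeAnnihilate_mul_self {n : ℕ} (x : EuclideanSpace ℂ (Fin n)) :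
    modeAnnihilate x * modeAnnihilate x = 0 := by
  ext i j
  exact self_eq_neg.mp (congrFun (congrFun (modeAnnihilate_mul_modeAnnihilate x x) i) j)

theorem modeAnnihilate_mul_conjTranspose_self {n : ℕ} {x : EuclideanSpace ℂ (Fin n)}
    (hx : ‖x‖ = 1) :
    modeAnnihilate x * (modeAnnihilate x)ᴴ = 1 - (modeAnnihilate x)ᴴ * modeAnnihilate x := by
  rw [modeAnnihilate_mul_conjTranspose, inner_self_eq_norm_sq_to_K, hx]
  simp

theorem modeAnnihilate_mul_conjTranspose_of_inner_eq_zero {n : ℕ}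
    {x y : EuclideanSpace ℂ (Fin n)} (h : inner ℂ x y = 0) :
    modeAnnihilate x * (modeAnnihilate y)ᴴ = -((modeAnnihilate y)ᴴ * modeAnnihilate x) := by
  rw [modeAnnihilate_mul_conjTranspose, h, zero_smul, zero_sub]

theorem emptyProj_eq {n : ℕ} {φ : EuclideanSpace ℂ (Fin n)} (hφ : ‖φ‖ = 1) :
    emptyProj φ = 1 - occProj φ :=
  modeAnnihilate_mul_conjTranspose_self hφ

theorem occProj_isHermitian {n : ℕ} (φ : EuclideanSpace ℂ (Fin n)) : (occProj φ)ᴴ = occProj φ := by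
  simp [occProj]

theorem emptyProj_isHermitian {n : ℕ} (φ : EuclideanSpace ℂ (Fin n)) :
    (emptyProj φ)ᴴ = emptyProj φ := by
  simp [emptyProj]

theorem occProj_mul_emptyProj {n : ℕ} (φ : EuclideanSpace ℂ (Fin n)) :
    occProj φ * emptyProj φ = 0 := by
  rw [occProj, emptyProj, mul_assoc, ← mul_assoc (modeAnnihilate φ), modeAnnihilate_mul_self]
  simp

theorem emptyProj_mul_occProj {n : ℕ} (φ : EuclideanSpace ℂ (Fin n)) :
    emptyProj φ * occProj φ = 0 := by
  simpa [occProj_isHermitian, emptyProj_isHermitian] using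
    congrArg Matrix.conjTranspose (occProj_mul_emptyProj φ)

theorem occProj_mul_self {n : ℕ} {φ : EuclideanSpace ℂ (Fin n)} (hφ : ‖φ‖ = 1) :
    occProj φ * occProj φ = occProj φ := by
  have := occProj_mul_emptyProj φ
  rw [emptyProj_eq hφ, mul_sub, mul_one, sub_eq_zero] at this
  exact this.symm

theorem emptyProj_mul_self {n : ℕ} {φ : EuclideanSpace ℂ (Fin n)} (hφ : ‖φ‖ = 1) :
    emptyProj φ * emptyProj φ = emptyProj φ := by
  have := emptyProj_mul_occProj φ
  rwa [← sub_sub_self 1 (occProj φ), ← emptyProj_eq hφ, mul_sub, mul_one, sub_eq_zero, eq_comm]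
    at this

theorem modeAnnihilate_ne_zero {n : ℕ} {φ : EuclideanSpace ℂ (Fin n)} (hφ : ‖φ‖ = 1) :
    modeAnnihilate φ ≠ 0 := by
  intro h
  have := modeAnnihilate_mul_conjTranspose_self hφ
  simp [h] at this

theorem occProj_ne_zero {n : ℕ} {φ : EuclideanSpace ℂ (Fin n)} (hφ : ‖φ‖ = 1) :
    occProj φ ≠ 0 := fun h =>
  modeAnnihilate_ne_zero hφ (Matrix.conjTranspose_mul_self_eq_zero.mp h)

theorem emptyProj_ne_zero {n : ℕ} {φ : EuclideanSpace ℂ (Fin n)} (hφ : ‖φ‖ = 1) :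
    emptyProj φ ≠ 0 := fun h =>
  modeAnnihilate_ne_zero hφ (Matrix.self_mul_conjTranspose_eq_zero.mp h)

/-- The Heisenberg picture of the occupation of a mode `c = s a + t b` under a Kraus operator of the
mode `a`. The first summand of the right-hand side sees the states with one particle in `a, b`, the
second one those with two. On the former, `K = α a†a + β aa†` acts as `(s, t) ↦ (α s, β t)`; the
latter have the mode `c` filled whatever it is, and `K` acts on them as multiplication by `α`. -/
theorem conjTranspose_mul_modes_mul {n : ℕ} {a b : Op n} (haa : a * a = 0) (hbb : b * b = 0)
    (hab : a * b = -(b * a)) (ha : a * aᴴ = 1 - aᴴ * a) (hb : b * bᴴ = 1 - bᴴ * b)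
    (hab' : a * bᴴ = -(bᴴ * a)) {s t : ℂ} (hst : ‖s‖ ^ 2 + ‖t‖ ^ 2 = 1) (α β : ℂ) :
    (α • (aᴴ * a) + β • (a * aᴴ))ᴴ * ((s • a + t • b)ᴴ * (s • a + t • b)) *
        (α • (aᴴ * a) + β • (a * aᴴ)) =
      ((α * s) • (a * (b * bᴴ)) + (β * t) • (b * (a * aᴴ)))ᴴ *
        ((α * s) • (a * (b * bᴴ)) + (β * t) • (b * (a * aᴴ))) +
      (‖α‖ ^ 2 : ℂ) • (aᴴ * a * (bᴴ * b)) := by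
  have hba' : b * aᴴ = -(aᴴ * b) := by
    simpa using congrArg Matrix.conjTranspose hab'
  have haad : aᴴ * aᴴ = 0 := by simpa using congrArg Matrix.conjTranspose haa
  have habd : bᴴ * aᴴ = -(aᴴ * bᴴ) := by simpa using congrArg Matrix.conjTranspose hab
  -- normal ordering, each rule also in the form that acts inside a longer product
  have aux {x y z : Op n} (h : x * y = z) (w : Op n) : x * (y * w) = z * w := by
    rw [← mul_assoc, h]
  have haa₁ := aux haa
  have hbb₁ := aux hbb
  have hab₁ := aux hab
  have ha₁ := aux ha
  have hb₁ := aux hb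
  have hab₁' := aux hab'
  have hba₁' := aux hba'
  have haad₁ := aux haad
  have habd₁ := aux habd
  have hc : (s • a + t • b) * (α • (aᴴ * a) + β • (a * aᴴ)) =
      (α * s) • a + (α * t) • (b * (aᴴ * a)) + (β * t) • (b * (a * aᴴ)) := by
    have h1 : a * (aᴴ * a) = a := by
      simp only [← mul_assoc, ha]; simp only [sub_mul, one_mul, mul_assoc, haa, mul_zero, sub_zero]
    rw [add_mul, mul_add, mul_add]
    simp only [Matrix.smul_mul, Matrix.mul_smul, smul_smul, h1, haa₁, zero_mul, smul_zero, add_zero]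
    module
  rw [mul_assoc, mul_assoc, ← mul_assoc _ᴴ _ᴴ, ← Matrix.conjTranspose_mul, hc]
  have e1 : aᴴ * (b * (aᴴ * a)) = 0 := by
    simp only [hba₁', haad₁, mul_neg, neg_mul, mul_assoc, zero_mul, neg_zero]
  obtain ⟨e2, e3, e4, e5⟩ :
      aᴴ * (b * (a * aᴴ)) = (a * (b * bᴴ))ᴴ * (b * (a * aᴴ)) ∧
      (b * (aᴴ * a))ᴴ * (b * (aᴴ * a)) = aᴴ * a * (bᴴ * b) ∧
      (b * (aᴴ * a))ᴴ * (b * (a * aᴴ)) = 0 ∧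
      (a * (b * bᴴ))ᴴ * (a * (b * bᴴ)) = aᴴ * a - aᴴ * a * (bᴴ * b) := by
    simp only [Matrix.conjTranspose_mul, Matrix.conjTranspose_conjTranspose]
    refine ⟨?_, ?_, ?_, ?_⟩ <;>
    simp only [mul_assoc, haa, hbb, hab, ha, hb, hab', hba', hbb₁, hab₁, ha₁, hb₁,
      hab₁', hba₁', haad₁, habd₁, sub_mul, mul_sub, one_mul, mul_one, neg_mul,
      mul_neg, neg_neg, mul_zero, zero_mul, sub_zero, sub_self, neg_zero]
  have e1' : (b * (aᴴ * a))ᴴ * a = 0 := by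
    simpa [mul_assoc] using congrArg Matrix.conjTranspose e1
  have e2' : (b * (a * aᴴ))ᴴ * a = (b * (a * aᴴ))ᴴ * (a * (b * bᴴ)) := by
    simpa [mul_assoc] using congrArg Matrix.conjTranspose e2
  have e4' : (b * (a * aᴴ))ᴴ * (b * (aᴴ * a)) = 0 := by
    simpa [mul_assoc] using congrArg Matrix.conjTranspose e4
  have hst' : s * conj s + t * conj t = 1 := by
    rw [Complex.mul_conj', Complex.mul_conj']; exact_mod_cast hst
  have hα : (‖α‖ ^ 2 : ℂ) = α * conj α := (Complex.mul_conj' α).symm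
  generalize b * (aᴴ * a) = u at *
  generalize b * (a * aᴴ) = v at *
  generalize a * (b * bᴴ) = f at *
  generalize aᴴ * a * (bᴴ * b) = w at *
  simp only [Matrix.conjTranspose_add, Matrix.conjTranspose_smul, add_mul, mul_add,
    Matrix.smul_mul, Matrix.mul_smul, smul_smul, e1, e2, e3, e4, e5, e1', e2', e4', hα, star_mul',
    RCLike.star_def, smul_zero, add_zero, zero_add]
  have : ∀ c : ℂ, c = s * conj s * c + t * conj t * c := fun c => by rw [← add_mul, hst', one_mul]
  rw [this (α * conj α)]
  module

/-! ### Mean occupation numbers under single-mode Kraus operators -/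

/-- The mean occupation number `Tr (ρ c_x† c_x)` of the mode `x`. -/
def occupation {n : ℕ} (ρ : Op n) (x : EuclideanSpace ℂ (Fin n)) : ℝ :=
  (ρ * ((modeAnnihilate x)ᴴ * modeAnnihilate x)).trace.re

theorem re_inner_toEuclideanLin_spdm {n : ℕ} (ρ : Op n) (x : EuclideanSpace ℂ (Fin n)) :
    (inner ℂ x (Matrix.toEuclideanLin (spdm ρ) x)).re = occupation ρ x := by
  rw [occupation, modeAnnihilate_conjTranspose, modeAnnihilate, Finset.sum_mul_sum,
    Finset.sum_comm]
  congr 1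
  simp only [PiLp.inner_apply, Matrix.toLpLin_apply, Matrix.mulVec, dotProduct, spdm,
    RCLike.inner_apply, Finset.mul_sum, Finset.sum_mul, Matrix.trace_sum, Matrix.smul_mul,
    Matrix.mul_smul, Matrix.trace_smul, smul_eq_mul]
  refine Finset.sum_congr rfl fun i _ => Finset.sum_congr rfl fun j _ => ?_
  ring

/-- Passage to the Heisenberg picture: `Tr (K ρ K† X) = Tr (ρ K† X K)`. -/
theorem trace_mul_mul_conjTranspose_mul {n : ℕ} (K ρ X : Op n) :
    (K * ρ * Kᴴ * X).trace = (ρ * (Kᴴ * X * K)).trace := by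
  rw [mul_assoc, mul_assoc, Matrix.trace_mul_comm]
  simp only [mul_assoc]

theorem occupation_conj {n : ℕ} (ρ : Op n) {k v : EuclideanSpace ℂ (Fin n)} (hk : ‖k‖ = 1)
    (hv : ‖v‖ = 1) (hkv : inner ℂ k v = 0) {s t : ℂ} (hst : ‖s‖ ^ 2 + ‖t‖ ^ 2 = 1) (α β : ℂ) :
    occupation ((α • occProj k + β • emptyProj k) * ρ * (α • occProj k + β • emptyProj k)ᴴ)
        (conj s • k + conj t • v) =
      (((α * s) • (modeAnnihilate k * emptyProj v) + (β * t) • (modeAnnihilate v * emptyProj k)) *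
        ρ * ((α * s) • (modeAnnihilate k * emptyProj v) +
          (β * t) • (modeAnnihilate v * emptyProj k))ᴴ).trace.re +
      ‖α‖ ^ 2 * (ρ * (occProj k * occProj v)).trace.re := by
  rw [occupation, trace_mul_mul_conjTranspose_mul, modeAnnihilate_add, modeAnnihilate_smul,
    modeAnnihilate_smul, Complex.conj_conj, Complex.conj_conj]
  simp only [occProj, emptyProj]
  rw [conjTranspose_mul_modes_mul (modeAnnihilate_mul_self k) (modeAnnihilate_mul_self v)
    (modeAnnihilate_mul_modeAnnihilate k v) (modeAnnihilate_mul_conjTranspose_self hk)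
    (modeAnnihilate_mul_conjTranspose_self hv)
    (modeAnnihilate_mul_conjTranspose_of_inner_eq_zero hkv) hst, mul_add, Matrix.trace_add,
    Complex.add_re, Matrix.mul_smul, Matrix.trace_smul, smul_eq_mul, ← Complex.ofReal_pow,
    Complex.re_ofReal_mul, ← mul_assoc ρ, Matrix.trace_mul_comm, ← mul_assoc]

/-- `occupation_conj` for the trivial Kraus operator `1`. -/
theorem occupation_eq {n : ℕ} (ρ : Op n) {k v : EuclideanSpace ℂ (Fin n)} (hk : ‖k‖ = 1)
    (hv : ‖v‖ = 1) (hkv : inner ℂ k v = 0) {s t : ℂ} (hst : ‖s‖ ^ 2 + ‖t‖ ^ 2 = 1) :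
    occupation ρ (conj s • k + conj t • v) =
      ((s • (modeAnnihilate k * emptyProj v) + t • (modeAnnihilate v * emptyProj k)) *
        ρ * (s • (modeAnnihilate k * emptyProj v) +
          t • (modeAnnihilate v * emptyProj k))ᴴ).trace.re +
      (ρ * (occProj k * occProj v)).trace.re := by
  have := occupation_conj ρ hk hv hkv hst 1 1
  simpa [emptyProj_eq hk] using this

/-- A measurement of the mode `k` preserves the mean occupation of the modes orthogonal to `k`. -/
theorem occupation_eq_sum_of_inner_eq_zero {n : ℕ} {ι : Type*} [Fintype ι] (ρ : Op n)
    {k v : EuclideanSpace ℂ (Fin n)} (hk : ‖k‖ = 1) (hv : ‖v‖ = 1) (hkv : inner ℂ k v = 0)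
    {α β : ι → ℂ} (hα : ∑ j, ‖α j‖ ^ 2 = 1) (hβ : ∑ j, ‖β j‖ ^ 2 = 1) :
    occupation ρ v = ∑ j, occupation ((α j • occProj k + β j • emptyProj k) * ρ *
      (α j • occProj k + β j • emptyProj k)ᴴ) v := by
  have h1 := occupation_eq ρ hk hv hkv (s := 0) (t := 1) (by simp)
  have h2 (j) := occupation_conj ρ hk hv hkv (s := 0) (t := 1) (by simp) (α j) (β j)
  simp only [map_zero, map_one, zero_smul, one_smul, zero_add, mul_zero, mul_one] at h1 h2
  simp only [h1, h2, Finset.sum_add_distrib, ← Finset.sum_mul, hα, one_mul]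
  congr 1
  simp only [Matrix.conjTranspose_smul, Matrix.smul_mul, Matrix.mul_smul, Matrix.trace_smul,
    smul_eq_mul, ← mul_assoc]
  simp only [RCLike.star_def, Complex.conj_mul', ← Complex.ofReal_pow, Complex.re_ofReal_mul,
    ← Finset.sum_mul, hβ, one_mul]

/-- After each outcome `j` of a measurement of the mode `k`, the mode `w` can be turned within
`span {k, w}` into some `u j` such that the mean occupation does not decrease on average. -/
theorem exists_occupation_le_sum {n : ℕ} {ι : Type*} [Fintype ι] {ρ : Op n} (hρ : ρ.PosSemidef)
    {k w : EuclideanSpace ℂ (Fin n)} (hk : ‖k‖ = 1) (hw : ‖w‖ = 1)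
    {α β : ι → ℂ} (hα : ∑ j, ‖α j‖ ^ 2 = 1) (hβ : ∑ j, ‖β j‖ ^ 2 = 1) :
    ∃ u : ι → EuclideanSpace ℂ (Fin n), (∀ j, ‖u j‖ = 1) ∧
      (∀ j, ∃ a b : ℂ, u j = a • k + b • w) ∧
      occupation ρ w ≤ ∑ j, occupation ((α j • occProj k + β j • emptyProj k) * ρ *
        (α j • occProj k + β j • emptyProj k)ᴴ) (u j) := by
  set c := inner ℂ k w with hc
  set r := w - c • k with hr
  have hkr : inner ℂ k r = 0 := by
    rw [hr, inner_sub_right, inner_smul_right, inner_self_eq_norm_sq_to_K, hk]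
    simp [hc]
  have hunit {v : EuclideanSpace ℂ (Fin n)} (hv : ‖v‖ = 1) (hkv : inner ℂ k v = 0) (a b : ℂ) :
      ‖a • k + b • v‖ ^ 2 = ‖a‖ ^ 2 + ‖b‖ ^ 2 := by
    rw [sq, norm_add_sq_eq_norm_sq_add_norm_sq_of_inner_eq_zero (𝕜 := ℂ) _ _
      (by simp [inner_smul_left, inner_smul_right, hkv])]
    simp [norm_smul, hk, hv, sq]
  -- if `w` is a multiple of `k` there is no second mode, and `u j = w` does
  by_cases hr0 : r = 0
  · have hwk : w = c • k := by rwa [hr, sub_eq_zero] at hr0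
    have hocc : ∀ j, occupation ((α j • occProj k + β j • emptyProj k) * ρ *
        (α j • occProj k + β j • emptyProj k)ᴴ) w = ‖α j‖ ^ 2 * occupation ρ w := by
      intro j
      have h1 : (α j • occProj k + β j • emptyProj k)ᴴ * occProj k *
          (α j • occProj k + β j • emptyProj k) = (‖α j‖ ^ 2 : ℂ) • occProj k := by
        simp only [Matrix.conjTranspose_add, Matrix.conjTranspose_smul, occProj_isHermitian,
          emptyProj_isHermitian, add_mul, mul_add, Matrix.smul_mul, Matrix.mul_smul,
          occProj_mul_self hk, emptyProj_mul_occProj, occProj_mul_emptyProj, smul_zero, add_zero,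
          smul_smul, RCLike.star_def, Complex.mul_conj']
      have h2 (σ : Op n) : occupation σ w = ‖c‖ ^ 2 * (σ * occProj k).trace.re := by
        rw [occupation, hwk, modeAnnihilate_smul, Matrix.conjTranspose_smul, Matrix.smul_mul,
          Matrix.mul_smul (modeAnnihilate k)ᴴ, smul_smul, RCLike.star_def, Complex.conj_conj, Complex.mul_conj',
          Matrix.mul_smul, Matrix.trace_smul, smul_eq_mul, ← Complex.ofReal_pow,
          Complex.re_ofReal_mul, occProj]
      rw [h2, h2, trace_mul_mul_conjTranspose_mul, h1, Matrix.mul_smul, Matrix.trace_smul,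
        smul_eq_mul, ← Complex.ofReal_pow, Complex.re_ofReal_mul]
      ring
    refine ⟨fun _ => w, fun _ => hw, fun _ => ⟨0, 1, by simp⟩, ?_⟩
    simp only [hocc, ← Finset.sum_mul, hα, one_mul, le_refl]
  · have hrn : ‖r‖ ≠ 0 := by simpa using hr0
    set v : EuclideanSpace ℂ (Fin n) := ((‖r‖ : ℂ))⁻¹ • r with hv
    have hvn : ‖v‖ = 1 := by simp [hv, norm_smul, hrn]
    have hkv : inner ℂ k v = 0 := by rw [hv, inner_smul_right, hkr, mul_zero]
    have hwv : w = conj (conj c) • k + conj (‖r‖ : ℂ) • v := by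
      rw [hv, Complex.conj_conj, Complex.conj_ofReal, smul_smul,
        mul_inv_cancel₀ (by exact_mod_cast hrn), one_smul, hr]
      abel
    have hst : ‖conj c‖ ^ 2 + ‖(‖r‖ : ℂ)‖ ^ 2 = 1 := by
      have := hunit hvn hkv (conj (conj c)) (conj (‖r‖ : ℂ))
      rw [← hwv, hw] at this
      simpa using this.symm
    obtain ⟨s, t, hu, hle⟩ := exists_unit_pairs_trace_le_sum hρ
      (modeAnnihilate k * emptyProj v) (modeAnnihilate v * emptyProj k) hst hα hβ
    refine ⟨fun j => conj (s j) • k + conj (t j) • v, fun j => ?_, fun j => ?_, ?_⟩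
    · rw [← sq_eq_sq₀ (norm_nonneg _) zero_le_one, hunit hvn hkv]
      simpa using hu j
    · refine ⟨conj (s j) - conj (t j) * (‖r‖ : ℂ)⁻¹ * c, conj (t j) * (‖r‖ : ℂ)⁻¹, ?_⟩
      rw [hv, hr]
      module
    · simp only [occupation_conj ρ hk hvn hkv (hu _), Finset.sum_add_distrib, ← Finset.sum_mul, hα,
        one_mul]
      conv_lhs => rw [hwv]
      rw [occupation_eq ρ hk hvn hkv hst]
      gcongr

/-! ### Average majorization -/

theorem occupation_smul {n : ℕ} (r : ℝ) (ρ : Op n) (x : EuclideanSpace ℂ (Fin n)) :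
    occupation (r • ρ) x = r * occupation ρ x := by
  simp [occupation, Matrix.trace_smul]

theorem ofReal_outcomeProb {n : ℕ} (K : Op n) {ρ : Op n} (hρ : ρ.PosSemidef) :
    (outcomeProb K ρ : ℂ) = (K * ρ * Kᴴ).trace := by
  have h := (hρ.mul_mul_conjTranspose_same K).trace_nonneg
  rw [← mul_one (K * ρ * Kᴴ), trace_mul_mul_conjTranspose_mul, mul_one] at h ⊢
  exact Complex.ext rfl (Complex.nonneg_iff.mp h).2

theorem outcomeProb_nonneg {n : ℕ} (K : Op n) {ρ : Op n} (hρ : ρ.PosSemidef) :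
    0 ≤ outcomeProb K ρ := by
  have h := (hρ.mul_mul_conjTranspose_same K).trace_nonneg
  rw [← ofReal_outcomeProb K hρ] at h
  exact_mod_cast h

/-- Weighting by the probability undoes the normalization of the conditional state, also when the
probability is `0`, since then `K ρ K†` is positive of trace `0`. -/
theorem outcomeProb_smul_postState {n : ℕ} (K : Op n) {ρ : Op n} (hρ : ρ.PosSemidef) :
    outcomeProb K ρ • postState K ρ = K * ρ * Kᴴ := by
  by_cases h : outcomeProb K ρ = 0
  · have h0 := ofReal_outcomeProb K hρ
    rw [h, Complex.ofReal_zero, eq_comm,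
      (hρ.mul_mul_conjTranspose_same K).trace_eq_zero_iff] at h0
    rw [h, h0, zero_smul]
  · rw [postState, smul_smul, mul_inv_cancel₀ h, one_smul]

theorem trace_spdm {n : ℕ} (ρ : Op n) : (spdm ρ).trace = (ρ * numberOp n).trace := by
  simp [Matrix.trace, spdm, numberOp, Finset.mul_sum, Matrix.sum_apply]
  exact Finset.sum_comm

theorem sum_spdmSpectrum {n : ℕ} (ρ : Op n) (h : ρ.IsHermitian) :
    ∑ i, spdmSpectrum ρ h i = (ρ * numberOp n).trace.re := by
  rw [← trace_spdm]
  exact sum_sortedEigenvalues _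

theorem sum_occupation_le {n m : ℕ} {ρ : Op n} (h : ρ.IsHermitian) (hm : m < n)
    {u : Fin m → EuclideanSpace ℂ (Fin n)} (hu : Orthonormal ℂ u) :
    ∑ i, occupation ρ (u i) ≤ ∑ l with (l : Fin n).val < m, spdmSpectrum ρ h l := by
  simp only [← re_inner_toEuclideanLin_spdm]
  exact sum_re_inner_le_sum_sortedEigenvalues _ hm hu

theorem sum_occupation_conj_le {n m : ℕ} (K : Op n) {ρ : Op n} (h : ρ.PosSemidef) (hm : m < n)
    {u : Fin m → EuclideanSpace ℂ (Fin n)} (hu : Orthonormal ℂ u) :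
    ∑ i, occupation (K * ρ * Kᴴ) (u i) ≤ ∑ l with (l : Fin n).val < m,
      outcomeProb K ρ * spdmSpectrum (postState K ρ) (postState_isHermitian K h.isHermitian) l := by
  simp only [← outcomeProb_smul_postState K h, occupation_smul, ← Finset.mul_sum]
  exact mul_le_mul_of_nonneg_left (sum_occupation_le _ hm hu) (outcomeProb_nonneg K h)

theorem orthonormal_update_zero {E : Type*} [NormedAddCommGroup E] [InnerProductSpace ℂ E] {m : ℕ}
    {w : Fin (m + 1) → E} (hw : Orthonormal ℂ w) {u : E} (hu : ‖u‖ = 1)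
    (h : ∀ i ≠ 0, inner ℂ u (w i) = 0) : Orthonormal ℂ (Function.update w 0 u) := by
  refine ⟨fun i => ?_, fun i j hij => ?_⟩
  · rcases eq_or_ne i 0 with rfl | hi
    · simpa using hu
    · simpa [hi] using hw.1 i
  · rcases eq_or_ne i 0 with rfl | hi
    · simpa [hij.symm] using h j hij.symm
    rcases eq_or_ne j 0 with rfl | hj
    · simpa [hi] using inner_eq_zero_symm.mp (h i hi)
    · simpa [hi, hj] using hw.2 hij

/-- The partial-sum inequalities of average majorization. A maximizing family for Ky Fan's inequality
is chosen with all members but one orthogonal to `k`; these are kept for all outcomes, and only the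
last one is adapted to the outcome, which keeps the family orthonormal. -/
theorem sum_spdmSpectrum_le {n : ℕ} {ι : Type*} [Fintype ι] {ρ : Op n} (hρ : ρ.PosSemidef)
    {k : EuclideanSpace ℂ (Fin n)} (hk : ‖k‖ = 1) {α β : ι → ℂ} (hα : ∑ j, ‖α j‖ ^ 2 = 1)
    (hβ : ∑ j, ‖β j‖ ^ 2 = 1) {K : ι → Op n}
    (hK : ∀ j, K j = α j • occProj k + β j • emptyProj k) {m : ℕ} (hm : m < n) :
    ∑ l with (l : Fin n).val < m, spdmSpectrum ρ hρ.isHermitian l ≤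
      ∑ l with (l : Fin n).val < m, ∑ j, outcomeProb (K j) ρ *
        spdmSpectrum (postState (K j) ρ) (postState_isHermitian (K j) hρ.isHermitian) l := by
  rcases m with _ | m
  · simp
  obtain ⟨w, hw, hkw, hsum⟩ :=
    exists_orthonormal_sum_re_inner_eq (spdm_isHermitian hρ.isHermitian) hm.le k
  obtain ⟨u, hu, hspan, hle⟩ := exists_occupation_le_sum hρ hk (hw.1 0) hα hβ
  simp only [← hK] at hle
  have hfr (j) : Orthonormal ℂ (Function.update w 0 (u j)) := by
    refine orthonormal_update_zero hw (hu j) fun i hi => ?_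
    obtain ⟨a, b, hab⟩ := hspan j
    rw [hab, inner_add_left, inner_smul_left, inner_smul_left, hkw i hi, hw.2 hi.symm]
    simp
  simp only [re_inner_toEuclideanLin_spdm] at hsum
  calc ∑ l with (l : Fin n).val < m + 1, spdmSpectrum ρ hρ.isHermitian l
      = ∑ i, occupation ρ (w i) := hsum.symm
    _ ≤ ∑ i, ∑ j, occupation (K j * ρ * (K j)ᴴ) (Function.update w 0 (u j) i) := by
        refine Finset.sum_le_sum fun i _ => ?_
        rcases eq_or_ne i 0 with rfl | hi
        · simpa using hle
        · simp only [Function.update_of_ne hi, hK]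
          exact (occupation_eq_sum_of_inner_eq_zero ρ hk (hw.1 i) (hkw i hi) hα hβ).le
    _ ≤ _ := by
        rw [Finset.sum_comm, Finset.sum_comm (s := Finset.univ.filter _)]
        exact Finset.sum_le_sum fun j _ => sum_occupation_conj_le (K j) hρ hm (hfr j)

theorem conjTranspose_mul_self_combination {n : ℕ} {k : EuclideanSpace ℂ (Fin n)} (hk : ‖k‖ = 1)
    (a b : ℂ) : (a • occProj k + b • emptyProj k)ᴴ * (a • occProj k + b • emptyProj k) =
      ((‖a‖ ^ 2 : ℝ) : ℂ) • occProj k + ((‖b‖ ^ 2 : ℝ) : ℂ) • emptyProj k := by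
  simp [add_mul, mul_add, occProj_isHermitian, emptyProj_isHermitian, occProj_mul_self hk,
    emptyProj_mul_self hk, occProj_mul_emptyProj, emptyProj_mul_occProj, smul_smul,
    Complex.mul_conj']

/-- Every family in the span of `P_k` and `c_k c_k†` with normalized coefficient vectors is an ONG
Kraus family. -/
theorem isONGKraus_of_eq_combination {n : ℕ} {ι : Type*} [Fintype ι]
    {k : EuclideanSpace ℂ (Fin n)} (hk : ‖k‖ = 1) {α β : ι → ℂ} (hα : ∑ j, ‖α j‖ ^ 2 = 1)
    (hβ : ∑ j, ‖β j‖ ^ 2 = 1) {K : ι → Op n}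
    (hK : ∀ j, K j = α j • occProj k + β j • emptyProj k) : IsONGKraus K := by
  have hcomm (j) : Commute (K j) (numberOp n) := by
    rw [hK, emptyProj_eq hk]
    exact ((commute_occProj_numberOp k).smul_left _).add_left
      (((Commute.one_left _).sub_left (commute_occProj_numberOp k)).smul_left _)
  have hcompl : ∑ j, (K j)ᴴ * K j = 1 := by
    simp only [hK, conjTranspose_mul_self_combination hk, Finset.sum_add_distrib, ← Finset.sum_smul,
      ← Complex.ofReal_sum, hα, hβ]
    simp [emptyProj_eq hk]
  refine ⟨hcompl, hcomm, fun ρ hρ => ⟨sortedEigenvalues_antitone _, ?_, ?_, ?_⟩⟩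
  · intro i i' hi
    exact Finset.sum_le_sum fun j _ => mul_le_mul_of_nonneg_left
      (sortedEigenvalues_antitone _ hi) (outcomeProb_nonneg _ hρ.posSemidef)
  · exact fun m hm => sum_spdmSpectrum_le hρ.posSemidef hk hα hβ hK hm
  · rw [Finset.sum_comm, sum_spdmSpectrum]
    have h (j) : outcomeProb (K j) ρ * (postState (K j) ρ * numberOp n).trace.re =
        (ρ * ((K j)ᴴ * K j * numberOp n)).trace.re := by
      rw [mul_assoc _ᴴ, (hcomm j).eq, ← mul_assoc _ᴴ, ← trace_mul_mul_conjTranspose_mul,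
        ← outcomeProb_smul_postState (K j) hρ.posSemidef]
      simp [Matrix.trace_smul]
    simp only [← Finset.mul_sum, sum_spdmSpectrum, h]
    rw [← Complex.re_sum, ← Matrix.trace_sum, ← Finset.mul_sum, ← Finset.sum_mul, hcompl, one_mul]

/-! ### Kraus representations of the occupation measurement -/

theorem krausMap_single {n : ℕ} {ι : Type*} [Fintype ι] (K : ι → Op n)
    (a b c d : Finset (Fin n)) :
    krausMap K (Matrix.single b d 1) a c = ∑ j, K j a b * conj (K j c d) := by
  simp [krausMap, Matrix.sum_apply, Matrix.mul_apply, Matrix.single_apply, ite_and]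

/-- For a linear functional `f`, the sum of the `|f (K_j)|²` depends on the channel only: it is a value
of the sesquilinear form given by the Choi matrix. -/
theorem sum_norm_sq_eq_krausMap {n : ℕ} {ι : Type*} [Fintype ι] (K : ι → Op n)
    (f : Op n →ₗ[ℂ] ℂ) :
    ((∑ j, ‖f (K j)‖ ^ 2 : ℝ) : ℂ) =
      ∑ p : Finset (Fin n) × Finset (Fin n), ∑ q : Finset (Fin n) × Finset (Fin n),
        f (Matrix.single p.1 p.2 1) * conj (f (Matrix.single q.1 q.2 1)) *
          krausMap K (Matrix.single p.2 q.2 1) p.1 q.1 := by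
  have hf (X : Op n) : f X = ∑ p : Finset (Fin n) × Finset (Fin n),
      X p.1 p.2 * f (Matrix.single p.1 p.2 1) := by
    conv_lhs => rw [Matrix.matrix_eq_sum_single X]
    simp only [map_sum, Fintype.sum_prod_type]
    refine Finset.sum_congr rfl fun a _ => Finset.sum_congr rfl fun b _ => ?_
    rw [← smul_eq_mul, ← map_smul, Matrix.smul_single, smul_eq_mul, mul_one]
  simp only [krausMap_single, Finset.mul_sum]
  rw [Finset.sum_congr rfl fun p _ => Finset.sum_comm, Finset.sum_comm, Complex.ofReal_sum]
  refine Finset.sum_congr rfl fun j _ => ?_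
  rw [Complex.ofReal_pow, ← Complex.mul_conj', hf, map_sum, Finset.sum_mul_sum]
  refine Finset.sum_congr rfl fun p _ => Finset.sum_congr rfl fun q _ => ?_
  rw [map_mul]
  ring

theorem sum_norm_sq_of_krausMap_eq {n : ℕ} {ι : Type*} [Fintype ι] {φ : EuclideanSpace ℂ (Fin n)}
    {K : ι → Op n} (hK : krausMap K = occupationChannel φ) (f : Op n →ₗ[ℂ] ℂ) :
    ∑ j, ‖f (K j)‖ ^ 2 = ‖f (occProj φ)‖ ^ 2 + ‖f (emptyProj φ)‖ ^ 2 := by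
  have hchan : occupationChannel φ = krausMap ![occProj φ, emptyProj φ] := by
    funext ρ
    simp [occupationChannel, krausMap, occProj_isHermitian, emptyProj_isHermitian]
  have h1 := sum_norm_sq_eq_krausMap K f
  rw [hK, hchan, ← sum_norm_sq_eq_krausMap] at h1
  simpa using Complex.ofReal_injective h1

/-- The Kraus operators of the occupation-measurement channel lie in the span of the two projectors:
by `sum_norm_sq_of_krausMap_eq`, a functional that vanishes on the projectors vanishes on each
`K_j`. The coordinates are `Tr (P K_j) / Tr P`, and similarly for the other projector. -/
theorem exists_combination_of_krausMap_eq {n : ℕ} {ι : Type*} [Fintype ι]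
    {φ : EuclideanSpace ℂ (Fin n)} (hφ : ‖φ‖ = 1) {K : ι → Op n}
    (hK : krausMap K = occupationChannel φ) :
    ∃ α β : ι → ℂ, ∑ j, ‖α j‖ ^ 2 = 1 ∧ ∑ j, ‖β j‖ ^ 2 = 1 ∧
      ∀ j, K j = α j • occProj φ + β j • emptyProj φ := by
  have htP : (occProj φ).trace ≠ 0 := fun h => occProj_ne_zero hφ
    ((Matrix.posSemidef_conjTranspose_mul_self (modeAnnihilate φ)).trace_eq_zero_iff.mp h)
  have htQ : (emptyProj φ).trace ≠ 0 := fun h => emptyProj_ne_zero hφ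
    ((Matrix.posSemidef_self_mul_conjTranspose (modeAnnihilate φ)).trace_eq_zero_iff.mp h)
  let p : Op n →ₗ[ℂ] ℂ := (occProj φ).trace⁻¹ •
    (Matrix.traceLinearMap _ ℂ ℂ ∘ₗ LinearMap.mulLeft ℂ (occProj φ))
  let q : Op n →ₗ[ℂ] ℂ := (emptyProj φ).trace⁻¹ •
    (Matrix.traceLinearMap _ ℂ ℂ ∘ₗ LinearMap.mulLeft ℂ (emptyProj φ))
  have hpP : p (occProj φ) = 1 := by simp [p, occProj_mul_self hφ, htP]
  have hpQ : p (emptyProj φ) = 0 := by simp [p, occProj_mul_emptyProj]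
  have hqP : q (occProj φ) = 0 := by simp [q, emptyProj_mul_occProj]
  have hqQ : q (emptyProj φ) = 1 := by simp [q, emptyProj_mul_self hφ, htQ]
  refine ⟨fun j => p (K j), fun j => q (K j), ?_, ?_, fun j => ?_⟩
  · simp [sum_norm_sq_of_krausMap_eq hK, hpP, hpQ]
  · simp [sum_norm_sq_of_krausMap_eq hK, hqP, hqQ]
  -- for each entry, the functional that compares both sides of the claim
  · ext a b
    let f : Op n →ₗ[ℂ] ℂ := Matrix.entryLinearMap ℂ ℂ a b - (occProj φ a b) • p -
      (emptyProj φ a b) • q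
    have h := sum_norm_sq_of_krausMap_eq hK f
    have hfP : f (occProj φ) = 0 := by simp [f, hpP, hqP]
    have hfQ : f (emptyProj φ) = 0 := by simp [f, hpQ, hqQ]
    rw [hfP, hfQ, norm_zero, zero_pow two_ne_zero, add_zero,
      Finset.sum_eq_zero_iff_of_nonneg fun j _ => sq_nonneg _] at h
    have hj : f (K j) = 0 := by simpa using h j (Finset.mem_univ j)
    have hj' : K j a b - occProj φ a b * p (K j) - emptyProj φ a b * q (K j) = 0 := hj
    rw [Matrix.add_apply, Matrix.smul_apply, Matrix.smul_apply, smul_eq_mul, smul_eq_mul]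
    linear_combination hj'

theorem sum_modeMeasurement {n : ℕ} {φ : EuclideanSpace ℂ (Fin n)} (hφ : ‖φ‖ = 1)
    (α β γ δ : ℂ) :
    ∑ j, (modeMeasurement φ α β γ δ j)ᴴ * modeMeasurement φ α β γ δ j =
      ((‖α‖ ^ 2 + ‖γ‖ ^ 2 : ℝ) : ℂ) • occProj φ + ((‖β‖ ^ 2 + ‖δ‖ ^ 2 : ℝ) : ℂ) • emptyProj φ := by
  rw [Fin.sum_univ_two]
  simp only [modeMeasurement, Matrix.cons_val_zero, Matrix.cons_val_one,
    conjTranspose_mul_self_combination hφ, Complex.ofReal_add, add_smul]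
  abel

theorem combination_eq_one_iff {n : ℕ} {φ : EuclideanSpace ℂ (Fin n)} (hφ : ‖φ‖ = 1) (a b : ℂ) :
    a • occProj φ + b • emptyProj φ = 1 ↔ a = 1 ∧ b = 1 := by
  refine ⟨fun h => ⟨?_, ?_⟩, ?_⟩
  · have := congrArg (occProj φ * ·) h
    simp only [mul_add, Matrix.mul_smul, occProj_mul_self hφ, occProj_mul_emptyProj, smul_zero,
      add_zero, mul_one] at this
    exact (smul_left_injective ℂ (occProj_ne_zero hφ)) (by simpa using this)
  · have := congrArg (emptyProj φ * ·) h
    simp only [mul_add, Matrix.mul_smul, emptyProj_mul_self hφ, emptyProj_mul_occProj, smul_zero,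
      zero_add, mul_one] at this
    exact (smul_left_injective ℂ (emptyProj_ne_zero hφ)) (by simpa using this)
  · rintro ⟨rfl, rfl⟩
    simp [emptyProj_eq hφ]

end Fermion

end

theorem corollary1 {n : ℕ} (φ : EuclideanSpace ℂ (Fin n)) (hφ : ‖φ‖ = 1) :
    (∀ α β γ δ : ℂ,
      (∑ j, (Fermion.modeMeasurement φ α β γ δ j)ᴴ * Fermion.modeMeasurement φ α β γ δ j = 1 ↔
        ‖α‖ ^ 2 + ‖γ‖ ^ 2 = 1 ∧ ‖β‖ ^ 2 + ‖δ‖ ^ 2 = 1)) ∧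
    (∀ α β γ δ : ℂ, ‖α‖ ^ 2 + ‖γ‖ ^ 2 = 1 → ‖β‖ ^ 2 + ‖δ‖ ^ 2 = 1 →
      Fermion.IsONGKraus (Fermion.modeMeasurement φ α β γ δ) ∧
      Fermion.IsONG (Fermion.krausMap (Fermion.modeMeasurement φ α β γ δ))) ∧
    (∀ (ι : Type*) [Fintype ι] (K : ι → Fermion.Op n),
      Fermion.krausMap K = Fermion.occupationChannel φ → Fermion.IsONGKraus K) := by
  have hONG (α β γ δ : ℂ) (hα : ‖α‖ ^ 2 + ‖γ‖ ^ 2 = 1) (hβ : ‖β‖ ^ 2 + ‖δ‖ ^ 2 = 1) :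
      Fermion.IsONGKraus (Fermion.modeMeasurement φ α β γ δ) :=
    Fermion.isONGKraus_of_eq_combination hφ (α := ![α, γ]) (β := ![β, δ]) (by simpa using hα)
      (by simpa using hβ) (by simp [Fin.forall_fin_two, Fermion.modeMeasurement])
  refine ⟨fun α β γ δ => ?_, fun α β γ δ hα hβ =>
    ⟨hONG α β γ δ hα hβ, 2, _, hONG α β γ δ hα hβ, rfl⟩, fun ι _ K hK => ?_⟩
  · rw [Fermion.sum_modeMeasurement hφ, Fermion.combination_eq_one_iff hφ, Complex.ofReal_eq_one,
      Complex.ofReal_eq_one]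
  · obtain ⟨α, β, hα, hβ, hK'⟩ := Fermion.exists_combination_of_krausMap_eq hφ hK
    exact Fermion.isONGKraus_of_eq_combination hφ hα hβ hK'
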